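/- Conventions. The distance between two edges of a graph is the number of vertices of a shortest path joining them (so incident edges are at distance $1$), and $\chi'_2(G)$ is the least number of colours in a colouring of the edges of $G$ in which no two distinct edges within distance $2$ have the same colour. Eigenvalues are those of the adjacency matrix, and $L(G)$ is the line graph of $G$. Balanced bipartite product. Let $G_1,G_2$ be bipartite graphs with parts $V_a=(v^a_1,\dots,v^a_{n_a})$ and $U_a=(u^a_1,\dots,u^a_{n_a})$ ($a=1,2$), ordered so that $v^a_j u^a_j$ is an edge of $G_a$ for every $j$. Then $G_1\bowtie G_2$ is the graph with vertex set $(V_1\times V_2)\cup(U_1\times U_2)$ whose edges are the pairs $(v^1_j,v)(u^1_j,u)$ with $1\le j\le n_1$ and $vu\in E(G_2)$ ($v\in V_2$, $u\in U_2$), and the pairs $(v,v^2_j)(u,u^2_j)$ with $1\le j\le n_2$ and $vu\in E(G_1)$ ($v\in V_1$, $u\in U_1$). Hoffman-type bound. Let $G$ be a $k$-regular graph such that $L(G)$ has distinct eigenvalues $2(k-1)=\theta'_0>\theta'_1>\dots>\theta'_{d'}$ with $d'\ge 2$, and let $\theta'_i$ be the largest of them with $\theta'_i\le -1$. The Hoffman-type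 lower bound for $\chi'_2(G)$ is $$B(G)=\frac{|E(G)|}{\left\lfloor |E(G)|\,\dfrac{\theta'_0+\theta'_i\theta'_{i-1}}{(\theta'_0-\theta'_i)(\theta'_0-\theta'_{i-1})}\right\rfloor}.$$ Proposition. Let $C_q$ and $C_{q'}$ be cycles with $q,q'\ge 3$ and $q\equiv q'\equiv 0 \pmod 4$, and let $H=C_q\bowtie C_{q'}$ (for any orderings as above). Suppose that either 1. $-2$ is not an eigenvalue of $H$, or 2. $-2$ is an eigenvalue of $H$ and $qq'\not\equiv 0\pmod 5$. Then the Hoffman-type bound applies to $H$ and is tight after rounding up to an integer: $\lceil B(H)\rceil=6=\chi'_2(H)$. -/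

import Mathlib

/-- A balanced bipartite structure on `G` with parts `V = (v 0, …, v (r-1))` and
`U = (u 0, …, u (r-1))`, ordered so that `v j` and `u j` are adjacent for every `j`
(a *matching ordering*). -/
structure MatchingOrdering {W : Type*} (G : SimpleGraph W) (r : ℕ) where
  v : Fin r → W
  u : Fin r → W
  /-- every vertex of `G` is listed exactly once -/
  bijective : Function.Bijective (Sum.elim v u)
  not_adj_v : ∀ i j, ¬ G.Adj (v i) (v j)
  not_adj_u : ∀ i j, ¬ G.Adj (u i) (u j)
  adj : ∀ j, G.Adj (v j) (u j)

/-- The balanced bipartite product `G₁ ⋈ G₂`, with vertex set `V₁ × V₂ ∪ U₁ × U₂`. The vertex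
`(v i, v j)` is written `Sum.inl (i, j)` and the vertex `(u i, u j)` is written `Sum.inr (i, j)`.
Edges join `(v i, v j)` to `(u k, u l)` when `i = k` and `v j` is adjacent to `u l` in `G₂`, or
`j = l` and `v i` is adjacent to `u k` in `G₁`. -/
def balBipProduct {W₁ W₂ : Type*} {G₁ : SimpleGraph W₁} {G₂ : SimpleGraph W₂} {r₁ r₂ : ℕ}
    (O₁ : MatchingOrdering G₁ r₁) (O₂ : MatchingOrdering G₂ r₂) :
    SimpleGraph ((Fin r₁ × Fin r₂) ⊕ (Fin r₁ × Fin r₂)) where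
  Adj
    | Sum.inl x, Sum.inr y => (x.1 = y.1 ∧ G₂.Adj (O₂.v x.2) (O₂.u y.2)) ∨
        (x.2 = y.2 ∧ G₁.Adj (O₁.v x.1) (O₁.u y.1))
    | Sum.inr y, Sum.inl x => (x.1 = y.1 ∧ G₂.Adj (O₂.v x.2) (O₂.u y.2)) ∨
        (x.2 = y.2 ∧ G₁.Adj (O₁.v x.1) (O₁.u y.1))
    | _, _ => False
  symm := ⟨by rintro (x | x) (y | y) h <;> exact h⟩
  loopless := ⟨by rintro (x | x) h <;> exact h⟩

/-- The graph on the edges of `G` in which two distinct edges are adjacent when they are within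
distance `t`, the distance between two edges being the number of vertices (that is, the length
plus one) of a shortest path between them. -/
def edgeDistGraph {V : Type*} (G : SimpleGraph V) (t : ℕ) : SimpleGraph G.edgeSet where
  Adj e f := e ≠ f ∧
    ∃ x ∈ (e : Sym2 V), ∃ y ∈ (f : Sym2 V), ∃ p : G.Walk x y, p.length + 1 ≤ t
  symm := ⟨fun _ _ ⟨hne, x, hx, y, hy, p, hp⟩ =>
    ⟨hne.symm, y, hy, x, hx, p.reverse, by simpa using hp⟩⟩
  loopless := ⟨fun _ h => h.1 rfl⟩

/-- The distance-`t` chromatic index: the least number of colours in a colouring of the edges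
in which distinct edges within distance `t` have different colours. -/
noncomputable def distChromaticIndex {V : Type*} (G : SimpleGraph V) (t : ℕ) : ℕ∞ :=
  (edgeDistGraph G t).chromaticNumber

open Classical in
/-- `μ` is an eigenvalue of the adjacency matrix of `G`. -/
def IsAdjEigenvalue {V : Type*} [Fintype V] (G : SimpleGraph V) (μ : ℝ) : Prop :=
  Module.End.HasEigenvalue (Matrix.toLin' (G.adjMatrix ℝ)) μ

open Classical in
/-- `B` is the value of the Hoffman-type lower bound for the distance-2 chromatic index of `G`,
and this bound applies to `G`. That is, `G` is `k`-regular, the distinct adjacency eigenvalues of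
the line graph are `2 (k - 1) = θ 0 > θ 1 > ⋯ > θ d` with `d ≥ 2`, `θ i.succ` is the largest one
that is at most `-1`, and `θ i.castSucc` is the one immediately preceding it. The eigenvalues
involved are determined by `G`, so there is at most one such `B`. -/
def IsHoffmanBoundTwo {V : Type*} [Fintype V] (G : SimpleGraph V) (B : ℝ) : Prop :=
  ∃ (k d : ℕ) (θ : Fin (d + 1) → ℝ) (i : Fin d),
    G.IsRegularOfDegree k ∧
    2 ≤ d ∧
    StrictAnti θ ∧
    (∀ μ : ℝ, μ ∈ Set.range θ ↔ IsAdjEigenvalue G.lineGraph μ) ∧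
    θ 0 = 2 * ((k : ℝ) - 1) ∧
    θ i.succ ≤ -1 ∧
    (∀ j, θ j ≤ -1 → θ j ≤ θ i.succ) ∧
    B = (G.edgeSet.ncard : ℝ) /
      (⌊(G.edgeSet.ncard : ℝ) * ((θ 0 + θ i.succ * θ i.castSucc) /
        ((θ 0 - θ i.succ) * (θ 0 - θ i.castSucc)))⌋ : ℝ)

/-!
Write `N` for the vertex-edge incidence matrix of a `k`-regular graph `G`. Since
`N Nᵀ = A(G) + k` and `Nᵀ N = A(L(G)) + 2`, the eigenvalues of `L(G)` other than `-2` and those of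
`G` other than `-k` correspond under the shift `μ ↦ μ + k - 2`.

A matching ordering of a cycle of length divisible by 4 gives a permutation `P` of the indices with
`v i` adjacent exactly to `u i` and `u (P i)`, together with a 2-colouring of the indices that `P`
flips. Hence `H` is the cubic bipartite graph on two copies of the set of index pairs in which
`inl x` is joined to `inr (σ t x)`, where `σ` lists the identity, `P × 1` and `1 × P'`. The
2-colouring makes `-1` an eigenvalue of `H`, so that `L(H)` has the eigenvalues `4`, `0` and `-2`,
of which `4` is the largest and `-2` the smallest.

*The bound.* Let `a ≤ -1 < b` be the two consecutive eigenvalues of `L(H)` around `-1`. Then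
`-2 ≤ a` and `b ≤ 0`, which forces `1/6 ≤ (4 + ab) / ((4 - a)(4 - b)) ≤ 1/5`, with equality on the
right only if `a = -1`, that is, if `-2` is an eigenvalue of `H`. In that case 5 does not divide
`|E(H)|`. As 6 divides `|E(H)|`, in every case the bound lies in `(5, 6]`
(`ceil_hoffmanRatio_eq_six`, `exists_isHoffmanBoundTwo_ceil_eq_six`).

*Five colours do not suffice.* An edge and its four incident edges are pairwise within distance 2,
so a colour class of a 5-colouring would be a perfect code in `L(H)`. Then 5 divides `|E(H)|`, and
the indicator vector of the class yields an eigenvector of `L(H)` for `-1`, which makes `-2` an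
eigenvalue of `H` (`of_edgeDistGraph_two_colorable`). The hypothesis rules out this combination.

*Six colours suffice.* Each of the three types of edges is split into two colour classes by a parity
of its left end (`edgeDistGraph_two_permBipartite_colorable`, `productParity_ne`).
-/

/-! ### The spectrum of the line graph of a regular graph -/

section LineGraphSpectrum

open Matrix

variable {V : Type*} {G : SimpleGraph V}

open Classical in
/-- Eigenvalues of the adjacency matrix, with an explicit eigenvector. -/
theorem isAdjEigenvalue_iff [Fintype V] {μ : ℝ} :
    IsAdjEigenvalue G μ ↔ ∃ x : V → ℝ, x ≠ 0 ∧ G.adjMatrix ℝ *ᵥ x = μ • x := by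
  unfold IsAdjEigenvalue
  constructor
  · intro h
    obtain ⟨x, hx⟩ := h.exists_hasEigenvector
    exact ⟨x, hx.2, by simpa using hx.apply_eq_smul⟩
  · rintro ⟨x, hx, h⟩
    exact Module.End.hasEigenvalue_of_hasEigenvector
      (Module.End.hasEigenvector_iff.2 ⟨Module.End.mem_eigenspace_iff.2 (by simpa using h), hx⟩)

open Classical in
variable (G) in
/-- The vertex-edge incidence matrix over `ℝ`. Its columns are indexed by the edges only, unlike
those of `SimpleGraph.incMatrix`, which are indexed by all of `Sym2 V`. -/
noncomputable def edgeIncMatrix : Matrix V G.edgeSet ℝ :=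
  (G.incMatrix ℝ).submatrix id Subtype.val

open Classical in
theorem edgeIncMatrix_apply (v : V) (e : G.edgeSet) :
    edgeIncMatrix G v e = if v ∈ (e : Sym2 V) then 1 else 0 := by
  simp [edgeIncMatrix, SimpleGraph.incMatrix_apply', SimpleGraph.incidenceSet]

variable [Fintype V]

open Classical in
theorem sum_edgeIncMatrix (e : G.edgeSet) : ∑ v, edgeIncMatrix G v e = 2 :=
  G.sum_incMatrix_apply_of_mem_edgeSet e.2

open Classical in
theorem edgeIncMatrix_transpose_mul :
    (edgeIncMatrix G)ᵀ * edgeIncMatrix G = G.lineGraph.adjMatrix ℝ + (2 : ℝ) • 1 := by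
  ext e f
  simp only [Matrix.mul_apply, transpose_apply, edgeIncMatrix_apply, mul_ite, mul_one, mul_zero,
    ← ite_and, Finset.sum_boole, Matrix.add_apply, SimpleGraph.adjMatrix_apply,
    Matrix.smul_apply, smul_eq_mul, Matrix.one_apply]
  by_cases hef : e = f
  · subst hef
    obtain ⟨e, he⟩ := e
    induction e with
    | _ a b =>
      have hab : a ≠ b := G.ne_of_adj he
      have : (Finset.univ.filter fun v => v ∈ s(a, b) ∧ v ∈ s(a, b)) = {a, b} := by
        ext; simp
      rw [this, Finset.card_pair hab]
      simp
  · by_cases hadj : G.lineGraph.Adj e f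
    · obtain ⟨v, hve, hvf⟩ := hadj.2
      -- two distinct edges share at most one vertex
      have : (Finset.univ.filter fun v => v ∈ (f : Sym2 V) ∧ v ∈ (e : Sym2 V)) = {v} := by
        ext w
        simp only [Finset.mem_filter, Finset.mem_univ, true_and, Finset.mem_singleton]
        constructor
        · rintro ⟨hwf, hwe⟩
          by_contra hwv
          exact hef (Subtype.ext (((Sym2.mem_and_mem_iff hwv).1 ⟨hwe, hve⟩).trans
            ((Sym2.mem_and_mem_iff hwv).1 ⟨hwf, hvf⟩).symm))
        · rintro rfl
          exact ⟨hvf, hve⟩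
      rw [this]
      simp [hadj, hef]
    · have : (Finset.univ.filter fun v => v ∈ (f : Sym2 V) ∧ v ∈ (e : Sym2 V)) = ∅ := by
        ext w
        simp only [Finset.mem_filter, Finset.mem_univ, true_and, Finset.notMem_empty, iff_false]
        rintro ⟨hwf, hwe⟩
        exact hadj ⟨hef, w, hwe, hwf⟩
      rw [this]
      simp [hadj, hef]

theorem dotProduct_self_pos_of_ne_zero {ι : Type*} [Fintype ι] {x : ι → ℝ} (hx : x ≠ 0) :
    0 < x ⬝ᵥ x :=
  lt_of_le_of_ne (Finset.sum_nonneg fun _ _ => mul_self_nonneg _)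
    fun h => hx (dotProduct_self_eq_zero.1 h.symm)

/-- Regularity, for whichever instance is used to count the neighbours. -/
theorem SimpleGraph.IsRegularOfDegree.degree_eq_of_fintype {W : Type*} {G : SimpleGraph W}
    [G.LocallyFinite] {k : ℕ} (hG : G.IsRegularOfDegree k) (v : W) [Fintype (G.neighborSet v)] :
    G.degree v = k := by
  convert! hG v

/-- `A(L(G)) + 2` is the Gram matrix `Nᵀ N` of the incidence matrix. -/
theorem neg_two_le_of_isAdjEigenvalue_lineGraph [Fintype G.edgeSet] {μ : ℝ}
    (h : IsAdjEigenvalue G.lineGraph μ) : -2 ≤ μ := by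
  classical
  obtain ⟨x, hx0, hx⟩ := isAdjEigenvalue_iff.1 h
  have hx' : (edgeIncMatrix G)ᵀ *ᵥ edgeIncMatrix G *ᵥ x = (μ + 2) • x := by
    rw [mulVec_mulVec, edgeIncMatrix_transpose_mul, add_mulVec, hx, smul_mulVec, one_mulVec,
      add_smul]
  have h1 : 0 ≤ x ⬝ᵥ ((edgeIncMatrix G)ᵀ *ᵥ edgeIncMatrix G *ᵥ x) := by
    rw [dotProduct_mulVec, vecMul_transpose]
    exact Finset.sum_nonneg fun _ _ => mul_self_nonneg _
  rw [hx', dotProduct_smul, smul_eq_mul] at h1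
  linarith [nonneg_of_mul_nonneg_left h1 (dotProduct_self_pos_of_ne_zero hx0)]

variable [G.LocallyFinite] {k : ℕ}

/-- The Laplacian `k - A` of a `k`-regular graph is positive semidefinite. -/
theorem IsAdjEigenvalue.le_of_isRegularOfDegree (hG : G.IsRegularOfDegree k) {μ : ℝ}
    (h : IsAdjEigenvalue G μ) : μ ≤ k := by
  classical
  obtain ⟨x, hx0, hx⟩ := isAdjEigenvalue_iff.1 h
  have h1 := (SimpleGraph.posSemidef_lapMatrix ℝ G).dotProduct_mulVec_nonneg x
  have h3 : G.lapMatrix ℝ *ᵥ x = (k - μ) • x := by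
    rw [SimpleGraph.lapMatrix, sub_mulVec, hx, sub_smul]
    congr 1
    ext v
    simp [SimpleGraph.degMatrix_mulVec_apply, hG.degree_eq_of_fintype]
  rw [h3, dotProduct_smul, smul_eq_mul, star_trivial] at h1
  linarith [nonneg_of_mul_nonneg_left h1 (dotProduct_self_pos_of_ne_zero hx0)]

theorem two_mul_ncard_edgeSet (hG : G.IsRegularOfDegree k) :
    2 * G.edgeSet.ncard = k * Fintype.card V := by
  classical
  have h := G.sum_degrees_eq_twice_card_edges
  rw [← G.coe_edgeFinset, Set.ncard_coe_finset, ← h]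
  simp [hG.degree_eq_of_fintype, mul_comm]

theorem isAdjEigenvalue_of_isRegularOfDegree [Nonempty V] (hG : G.IsRegularOfDegree k) :
    IsAdjEigenvalue G k := by
  classical
  refine isAdjEigenvalue_iff.2 ⟨Function.const V 1, fun h => ?_, ?_⟩
  · simpa using congrFun h (Classical.arbitrary V)
  · ext v
    simp [hG.degree_eq_of_fintype]

variable [Fintype G.edgeSet]

open Classical in
theorem edgeIncMatrix_mul_transpose (hG : G.IsRegularOfDegree k) :
    edgeIncMatrix G * (edgeIncMatrix G)ᵀ = G.adjMatrix ℝ + (k : ℝ) • 1 := by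
  have h : edgeIncMatrix G * (edgeIncMatrix G)ᵀ = G.incMatrix ℝ * (G.incMatrix ℝ)ᵀ := by
    ext a b
    simp only [Matrix.mul_apply, transpose_apply]
    symm
    calc ∑ e, G.incMatrix ℝ a e * G.incMatrix ℝ b e
        = ∑ e ∈ G.edgeFinset, G.incMatrix ℝ a e * G.incMatrix ℝ b e := by
          symm
          apply Finset.sum_subset (Finset.subset_univ _)
          intro e _ he
          rw [G.incMatrix_of_notMem_incidenceSet fun h => he (by simpa using h.1), zero_mul]
      _ = _ := Finset.sum_subtype _ (by simp) _
  rw [h, SimpleGraph.incMatrix_mul_transpose]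
  ext a b
  by_cases hab : a = b
  · subst hab
    simp [hG.degree_eq_of_fintype]
  · simp [hab, SimpleGraph.adjMatrix_apply]

/-- The incidence matrix carries eigenvectors of the line graph to eigenvectors of the graph. -/
theorem IsAdjEigenvalue.of_lineGraph (hG : G.IsRegularOfDegree k) {μ : ℝ}
    (h : IsAdjEigenvalue G.lineGraph μ) (hμ : μ ≠ -2) : IsAdjEigenvalue G (μ + 2 - k) := by
  classical
  obtain ⟨x, hx0, hx⟩ := isAdjEigenvalue_iff.1 h
  have hx' : (edgeIncMatrix G)ᵀ *ᵥ edgeIncMatrix G *ᵥ x = (μ + 2) • x := by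
    rw [mulVec_mulVec, edgeIncMatrix_transpose_mul, add_mulVec, hx, smul_mulVec, one_mulVec,
      add_smul]
  refine isAdjEigenvalue_iff.2 ⟨edgeIncMatrix G *ᵥ x, fun h0 => ?_, ?_⟩
  · rw [h0, mulVec_zero, eq_comm, smul_eq_zero] at hx'
    exact hx'.elim (fun h => hμ (by linarith)) hx0
  · have := congrArg (edgeIncMatrix G *ᵥ ·) hx'
    simp only [mulVec_smul] at this
    rw [mulVec_mulVec, edgeIncMatrix_mul_transpose hG, add_mulVec, smul_mulVec, one_mulVec]
      at this
    rw [sub_smul, ← this, add_sub_cancel_right]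

/-- The transpose of the incidence matrix carries eigenvectors of a regular graph to eigenvectors
of its line graph. -/
theorem IsAdjEigenvalue.lineGraph (hG : G.IsRegularOfDegree k) {μ : ℝ}
    (h : IsAdjEigenvalue G μ) (hμ : μ ≠ -k) : IsAdjEigenvalue G.lineGraph (μ + k - 2) := by
  classical
  obtain ⟨x, hx0, hx⟩ := isAdjEigenvalue_iff.1 h
  have hx' : edgeIncMatrix G *ᵥ (edgeIncMatrix G)ᵀ *ᵥ x = (μ + k) • x := by
    rw [mulVec_mulVec, edgeIncMatrix_mul_transpose hG, add_mulVec, hx, smul_mulVec, one_mulVec,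
      add_smul]
  refine isAdjEigenvalue_iff.2 ⟨(edgeIncMatrix G)ᵀ *ᵥ x, fun h0 => ?_, ?_⟩
  · rw [h0, mulVec_zero, eq_comm, smul_eq_zero] at hx'
    exact hx'.elim (fun h => hμ (by linarith)) hx0
  · have := congrArg ((edgeIncMatrix G)ᵀ *ᵥ ·) hx'
    simp only [mulVec_smul] at this
    rw [mulVec_mulVec, edgeIncMatrix_transpose_mul, add_mulVec, smul_mulVec, one_mulVec] at this
    rw [sub_smul, ← this, add_sub_cancel_right]

/-- A regular graph of degree at least 3 has more edges than vertices, so its incidence matrix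
has a nontrivial kernel. -/
theorem isAdjEigenvalue_lineGraph_neg_two [Nonempty V] (hG : G.IsRegularOfDegree k)
    (hk : 3 ≤ k) : IsAdjEigenvalue G.lineGraph (-2) := by
  classical
  have hlt : Module.finrank ℝ (V → ℝ) < Module.finrank ℝ (G.edgeSet → ℝ) := by
    have := two_mul_ncard_edgeSet hG
    rw [← Nat.card_coe_set_eq, Nat.card_eq_fintype_card] at this
    have : 0 < Fintype.card V := Fintype.card_pos
    simp only [Module.finrank_fintype_fun_eq_card]
    nlinarith
  obtain ⟨x, hx, hx0⟩ := (Submodule.ne_bot_iff _).1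
    (LinearMap.ker_ne_bot_of_finrank_lt (f := (edgeIncMatrix G).mulVecLin) hlt)
  have hx : edgeIncMatrix G *ᵥ x = 0 := by simpa using hx
  refine isAdjEigenvalue_iff.2 ⟨x, hx0, ?_⟩
  have h := congrArg (· *ᵥ x) (edgeIncMatrix_transpose_mul (G := G))
  simp only [← mulVec_mulVec, hx, mulVec_zero, add_mulVec, smul_mulVec, one_mulVec] at h
  rw [neg_smul]
  exact eq_neg_of_add_eq_zero_left h.symm

open Classical in
/-- Every row of `A(L(G)) + 2 = Nᵀ N` sums to `2 k`. -/
theorem adjMatrix_lineGraph_mulVec_const (hG : G.IsRegularOfDegree k) (a : ℝ) :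
    (G.lineGraph.adjMatrix ℝ *ᵥ fun _ => a) = fun _ => (2 * k - 2) * a := by
  classical
  have h1 : (edgeIncMatrix G *ᵥ fun _ => a) = fun _ => k * a := by
    ext v
    have h := congrFun (congrFun (edgeIncMatrix_mul_transpose hG) v) v
    simp only [Matrix.mul_apply, transpose_apply, edgeIncMatrix_apply, mul_ite, mul_one, mul_zero,
      Matrix.add_apply, SimpleGraph.adjMatrix_apply, SimpleGraph.irrefl, if_false,
      Matrix.smul_apply, Matrix.one_apply_eq, zero_add, smul_eq_mul, ← ite_and, and_self] at h
    simp only [mulVec, dotProduct, ← Finset.sum_mul, edgeIncMatrix_apply, h]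
  have h2 : ((edgeIncMatrix G)ᵀ *ᵥ fun _ => k * a) = fun _ => 2 * (k * a) := by
    ext e
    simp only [mulVec, dotProduct, transpose_apply, ← Finset.sum_mul, sum_edgeIncMatrix]
  have h3 := congrArg (· *ᵥ fun _ => a) (edgeIncMatrix_transpose_mul (G := G))
  simp only [← mulVec_mulVec, h1, h2, add_mulVec, smul_mulVec, one_mulVec] at h3
  ext e
  have h4 := congrFun h3 e
  simp only [Pi.add_apply, Pi.smul_apply, smul_eq_mul] at h4
  linarith

end LineGraphSpectrum

/-! ### The Hoffman-type bound for cubic graphs -/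

section HoffmanBound

/-- The elements of a finite set of reals, listed in decreasing order. -/
theorem exists_strictAnti_range_eq {S : Set ℝ} (hS : S.Finite) {n : ℕ} (hn : n < S.ncard) :
    ∃ d, n ≤ d ∧ ∃ θ : Fin (d + 1) → ℝ, StrictAnti θ ∧ Set.range θ = S := by
  have hcard : hS.toFinset.card = S.ncard - 1 + 1 := by
    rw [← Set.ncard_eq_toFinset_card S hS]
    omega
  refine ⟨S.ncard - 1, by omega, fun j => hS.toFinset.orderEmbOfFin hcard j.rev, ?_, ?_⟩
  · intro i j hij
    simpa using hij
  · exact (Fin.rev_surjective.range_comp (hS.toFinset.orderEmbOfFin hcard)).trans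
      ((hS.toFinset.range_orderEmbOfFin hcard).trans hS.coe_toFinset)

/-- For `a ≤ -1 < b` the Hoffman-type ratio of a cubic graph is at most `1/5`, with equality only
if `a = -1`, because `20 + 5ab - (4-a)(4-b) = 4(1+a)(1+b)`; for `-2 ≤ a` and `b ≤ 0` it is at least
`1/6`. -/
theorem ceil_hoffmanRatio_eq_six {m : ℕ} (hm : 0 < m) {a b : ℝ} (ha2 : -2 ≤ a) (ha1 : a ≤ -1)
    (hb1 : -1 < b) (hb0 : b ≤ 0) (h5 : a = -1 → ¬ 5 ∣ 6 * m) :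
    ⌈((6 * m : ℕ) : ℝ) / (⌊((6 * m : ℕ) : ℝ) * ((4 + a * b) / ((4 - a) * (4 - b)))⌋ : ℝ)⌉ = 6 := by
  have hD : 0 < (4 - a) * (4 - b) := mul_pos (by linarith) (by linarith)
  have hm' : (0 : ℝ) < m := by exact_mod_cast hm
  set ρ := (4 + a * b) / ((4 - a) * (4 - b)) with hρ
  set F := ⌊((6 * m : ℕ) : ℝ) * ρ⌋ with hF
  have hlow : 1 / 6 ≤ ρ := by
    rw [hρ, div_le_div_iff₀ (by norm_num) hD]
    nlinarith [mul_nonneg (sub_nonneg.2 ha2) (sub_nonneg.2 hb0),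
      mul_nonneg (sub_nonneg.2 ha1) (sub_nonneg.2 hb0)]
  have hupp : ρ ≤ 1 / 5 := by
    rw [hρ, div_le_div_iff₀ hD (by norm_num)]
    nlinarith [mul_nonneg (sub_nonneg.2 ha1) (sub_nonneg.2 hb1.le)]
  have hupp' : a < -1 → ρ < 1 / 5 := fun h => by
    rw [hρ, div_lt_div_iff₀ hD (by norm_num)]
    nlinarith [mul_pos (sub_pos.2 h) (sub_pos.2 hb1)]
  have hmF : (m : ℤ) ≤ F := by
    rw [hF, Int.le_floor]
    push_cast
    nlinarith
  have hF5 : 5 * F < 6 * m := by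
    have hFle : (F : ℝ) ≤ ((6 * m : ℕ) : ℝ) * ρ := Int.floor_le _
    push_cast at hFle
    rcases ha1.lt_or_eq with h | h
    · have := hupp' h
      have : (5 * F : ℝ) < 6 * m := by nlinarith
      exact_mod_cast this
    · have : (5 * F : ℝ) ≤ 6 * m := by nlinarith
      have hle : 5 * F ≤ 6 * m := by exact_mod_cast this
      have := h5 h
      omega
  have hF0 : (0 : ℝ) < F := by exact_mod_cast (by omega : 0 < F)
  rw [Int.ceil_eq_iff, lt_div_iff₀ hF0, div_le_iff₀ hF0]
  constructor
  · have : (5 * F : ℝ) < 6 * m := by exact_mod_cast hF5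
    push_cast
    linarith
  · have : (m : ℝ) ≤ F := by exact_mod_cast hmF
    push_cast
    linarith

/-- The Hoffman-type bound of a cubic graph with eigenvalue `-1` rounds up to `6`. The line graph
has least eigenvalue `-2` and, from the eigenvalue `-1` of the graph, the eigenvalue `0`, so the two
eigenvalues of the line graph around `-1` lie in `[-2, -1]` and `(-1, 0]`. -/
theorem exists_isHoffmanBoundTwo_ceil_eq_six {V : Type*} [Fintype V] [Nonempty V]
    {G : SimpleGraph V} [G.LocallyFinite] (hG : G.IsRegularOfDegree 3) {m : ℕ}
    (hm : G.edgeSet.ncard = 6 * m) (h1 : IsAdjEigenvalue G (-1))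
    (h2 : IsAdjEigenvalue G (-2) → ¬ 5 ∣ G.edgeSet.ncard) :
    ∃ B : ℝ, IsHoffmanBoundTwo G B ∧ ⌈B⌉ = 6 := by
  classical
  have hL4 : IsAdjEigenvalue G.lineGraph 4 := by
    have := (isAdjEigenvalue_of_isRegularOfDegree hG).lineGraph hG (by norm_num)
    norm_num at this
    convert! this
  have hL0 : IsAdjEigenvalue G.lineGraph 0 := by
    have := h1.lineGraph hG (by norm_num)
    norm_num at this
    convert! this
  have hL2 : IsAdjEigenvalue G.lineGraph (-2) := isAdjEigenvalue_lineGraph_neg_two hG le_rfl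
  have hLmax : ∀ μ, IsAdjEigenvalue G.lineGraph μ → μ ≤ 4 := fun μ hμ => by
    by_cases h : μ = -2
    · linarith
    · have := (hμ.of_lineGraph hG h).le_of_isRegularOfDegree hG
      push_cast at this
      linarith
  have hL1 : IsAdjEigenvalue G.lineGraph (-1) → ¬ 5 ∣ 6 * m := fun h => by
    have := h.of_lineGraph hG (by norm_num)
    norm_num at this
    exact hm ▸ h2 this
  have hfin : {μ : ℝ | IsAdjEigenvalue G.lineGraph μ}.Finite :=
    Module.End.finite_hasEigenvalue _
  have hcard : 2 < {μ : ℝ | IsAdjEigenvalue G.lineGraph μ}.ncard := by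
    rw [Set.two_lt_ncard_iff hfin]
    exact ⟨4, 0, -2, hL4, hL0, hL2, by norm_num, by norm_num, by norm_num⟩
  obtain ⟨d, hd, θ, hθ, hrange⟩ := exists_strictAnti_range_eq hfin hcard
  have hspec : ∀ μ : ℝ, μ ∈ Set.range θ ↔ IsAdjEigenvalue G.lineGraph μ := fun μ => by
    rw [hrange]; rfl
  have hev : ∀ j, IsAdjEigenvalue G.lineGraph (θ j) := fun j => (hspec _).1 ⟨j, rfl⟩
  have hθ0 : θ 0 = 4 := by
    obtain ⟨j, hj⟩ := (hspec 4).2 hL4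
    exact le_antisymm (hLmax _ (hev 0)) (hj ▸ hθ.antitone (Fin.zero_le j))
  -- the first index at which the eigenvalue is at most `-1` exists, and is not `0`
  obtain ⟨i, hi, hi'⟩ : ∃ i : Fin d, θ i.succ ≤ -1 ∧ -1 < θ i.castSucc := by
    by_contra! hcon
    have hall : ∀ j : Fin (d + 1), -1 < θ j := fun j => by
      induction j using Fin.induction with
      | zero => rw [hθ0]; norm_num
      | succ i ih =>
        by_contra! h
        exact absurd (hcon i h) (not_le.2 ih)
    obtain ⟨j, hj⟩ := (hspec (-2)).2 hL2
    linarith [hall j]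
  have hge : ∀ j, θ j ≤ -1 → i.succ ≤ j := fun j hj => by
    by_contra! h
    linarith [hθ.antitone (Fin.le_castSucc_iff.2 h)]
  have hi0 : θ i.castSucc ≤ 0 := by
    obtain ⟨j, hj⟩ := (hspec 0).2 hL0
    by_contra! h
    have : i.castSucc < j := hθ.lt_iff_gt.1 (hj ▸ h)
    linarith [hθ.antitone (Fin.castSucc_lt_iff_succ_le.1 this)]
  refine ⟨_, ⟨3, d, θ, i, ?_, hd, hθ, ?_, ?_, hi, fun j hj => hθ.antitone (hge j hj), rfl⟩, ?_⟩
  · intro v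
    convert! hG v
  · intro μ
    convert! hspec μ
  · rw [hθ0]
    norm_num
  · have hm0 : 0 < m := by
      have := two_mul_ncard_edgeSet hG
      have : 0 < Fintype.card V := Fintype.card_pos
      omega
    rw [hm, hθ0]
    refine ceil_hoffmanRatio_eq_six hm0 (neg_two_le_of_isAdjEigenvalue_lineGraph (hev _)) hi hi'
      hi0 fun h => hL1 (h ▸ hev _)

end HoffmanBound

/-! ### Lower bound for the distance-2 chromatic index -/

section LowerBound

open Matrix

variable {V : Type*} [Fintype V] {G : SimpleGraph V} [G.LocallyFinite] [Fintype G.edgeSet] {k : ℕ}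

open Classical in
/-- An edge and the edges incident to it are pairwise within distance 2. If only as many colours are
used as there are edges in such a closed neighbourhood, then each colour occurs exactly once in
it. -/
theorem sum_indicator_color_eq_one (hG : G.IsRegularOfDegree k) (hk : 1 ≤ k)
    (C : (edgeDistGraph G 2).Coloring (Fin (2 * k - 1))) (c : Fin (2 * k - 1)) (e : G.edgeSet) :
    (G.lineGraph.adjMatrix ℝ *ᵥ fun f => if C f = c then 1 else 0) e +
      (if C e = c then 1 else 0) = 1 := by
  set K := insert e (G.lineGraph.neighborFinset e) with hK
  have hcard : K.card = 2 * k - 1 := by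
    rw [hK, Finset.card_insert_of_notMem (by simp), SimpleGraph.card_neighborFinset_eq_degree]
    have h := congrFun (adjMatrix_lineGraph_mulVec_const hG 1) e
    simp only [SimpleGraph.adjMatrix_mulVec_apply, Finset.sum_const, nsmul_eq_mul, mul_one,
      SimpleGraph.card_neighborFinset_eq_degree] at h
    have h' : G.lineGraph.degree e + 2 = 2 * k := by
      have : ((G.lineGraph.degree e + 2 : ℕ) : ℝ) = (2 * k : ℕ) := by
        push_cast
        linarith
      exact_mod_cast this
    omega
  have hshare : ∀ f ∈ K, ∃ v, v ∈ (e : Sym2 V) ∧ v ∈ (f : Sym2 V) := fun f hf => by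
    rw [hK, Finset.mem_insert, SimpleGraph.mem_neighborFinset] at hf
    rcases hf with rfl | hf
    · exact ⟨_, Sym2.out_fst_mem _, Sym2.out_fst_mem _⟩
    · exact hf.2
  have hinj : Set.InjOn C K := fun f hf g hg hfg => by
    by_contra hne
    obtain ⟨v, hve, hvf⟩ := hshare f hf
    obtain ⟨w, hwe, hwg⟩ := hshare g hg
    refine C.valid ⟨hne, v, hvf, w, hwg, ?_⟩ hfg
    by_cases hvw : v = w
    · subst hvw
      exact ⟨.nil, by simp⟩
    · have he : G.Adj v w := by
        rw [← SimpleGraph.mem_edgeSet, ← (Sym2.mem_and_mem_iff hvw).1 ⟨hve, hwe⟩]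
        exact e.2
      exact ⟨he.toWalk, by simp⟩
  have himage : K.image C = Finset.univ := by
    rw [← Finset.card_eq_iff_eq_univ, Finset.card_image_of_injOn hinj, hcard, Fintype.card_fin]
  obtain ⟨f, hf, hfc⟩ := Finset.mem_image.1 (himage ▸ Finset.mem_univ c : c ∈ K.image C)
  have hsum : (∑ g ∈ K, if C g = c then (1 : ℝ) else 0) = 1 := by
    rw [Finset.sum_eq_single_of_mem f hf fun g hg hgf => if_neg fun h =>
      hgf (hinj hg hf (h.trans hfc.symm)), if_pos hfc]
  rw [hK, Finset.sum_insert (by simp), add_comm] at hsum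
  rw [SimpleGraph.adjMatrix_mulVec_apply]
  exact hsum

/-- If the edges of a `k`-regular graph are coloured with `2 k - 1` colours, then each colour class
is a perfect code in the line graph: with indicator vector `x`, `(A(L(G)) + 1) x = 1`. So `-1` is an
eigenvalue of the line graph, with eigenvector `(2 k - 1) x - 1`, and `2 k - 1` divides the number
of edges. -/
theorem of_edgeDistGraph_two_colorable [Nonempty V] (hG : G.IsRegularOfDegree k) (hk : 2 ≤ k)
    (h : (edgeDistGraph G 2).Colorable (2 * k - 1)) :
    IsAdjEigenvalue G.lineGraph (-1) ∧ 2 * k - 1 ∣ G.edgeSet.ncard := by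
  classical
  obtain ⟨C⟩ := h
  have hk' : ((2 * k - 1 : ℕ) : ℝ) = 2 * k - 1 := by
    rw [Nat.cast_sub (by omega)]
    simp
  let c : Fin (2 * k - 1) := ⟨0, by omega⟩
  set x : G.edgeSet → ℝ := fun f => if C f = c then 1 else 0 with hx
  have hone : G.lineGraph.adjMatrix ℝ *ᵥ x = (fun _ => 1) - x := by
    ext e
    have := sum_indicator_color_eq_one hG (by omega) C c e
    rw [Pi.sub_apply]
    linarith
  have hpos : 0 < G.edgeSet.ncard := by
    have := two_mul_ncard_edgeSet hG
    have : 0 < Fintype.card V := Fintype.card_pos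
    by_contra! h0
    have : 0 < k * Fintype.card V := by positivity
    omega
  obtain ⟨e₀⟩ : Nonempty G.edgeSet := (Set.nonempty_of_ncard_ne_zero hpos.ne').to_subtype
  constructor
  · refine isAdjEigenvalue_iff.2 ⟨(2 * k - 1 : ℝ) • x - fun _ => 1, fun h0 => ?_, ?_⟩
    · have h1 := congrFun h0 e₀
      have hk2 : (2 : ℝ) ≤ k := by exact_mod_cast hk
      simp only [hx, Pi.sub_apply, Pi.smul_apply, smul_eq_mul, Pi.zero_apply] at h1
      split_ifs at h1 <;> linarith
    · ext e
      have h1 := congrFun hone e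
      have h2 := congrFun (adjMatrix_lineGraph_mulVec_const hG 1) e
      rw [mulVec_sub, mulVec_smul]
      simp only [Pi.sub_apply, Pi.smul_apply, smul_eq_mul, h1, h2]
      ring
  · -- sum `(A + 1) x = 1` over all edges, using that the columns of `A` sum to `2 k - 2`
    have h1 : (fun _ => 1) ⬝ᵥ G.lineGraph.adjMatrix ℝ *ᵥ x = (2 * k - 2) * ∑ f, x f := by
      rw [dotProduct_mulVec, ← mulVec_transpose, SimpleGraph.transpose_adjMatrix,
        adjMatrix_lineGraph_mulVec_const hG]
      simp [dotProduct, Finset.mul_sum]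
    have h2 : ∑ f, x f = ((Finset.univ.filter fun f => C f = c).card : ℝ) := by
      simp [hx, Finset.sum_boole]
    rw [hone] at h1
    simp only [dotProduct, Pi.sub_apply, one_mul, Finset.sum_sub_distrib, Finset.sum_const,
      Finset.card_univ, nsmul_eq_mul, mul_one, h2] at h1
    refine ⟨(Finset.univ.filter fun f => C f = c).card, ?_⟩
    rw [← Nat.card_coe_set_eq, Nat.card_eq_fintype_card]
    rw [← Nat.cast_inj (R := ℝ), Nat.cast_mul, hk']
    linarith

end LowerBound

/-! ### Bipartite graphs given by permutations -/

section PermBipartite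

variable {T ι : Type*}

/-- The bipartite graph on two copies of `T` in which `inl x` is joined to `inr (σ t x)` for every
`t`. If the values `σ t x` are distinct for distinct `t`, then the edges are the pairs `(x, t)`. -/
def permBipartite (σ : ι → Equiv.Perm T) : SimpleGraph (T ⊕ T) where
  Adj
    | Sum.inl x, Sum.inr y => ∃ t, σ t x = y
    | Sum.inr y, Sum.inl x => ∃ t, σ t x = y
    | _, _ => False
  symm := ⟨by rintro (x | x) (y | y) h <;> exact h⟩
  loopless := ⟨by rintro (x | x) h <;> exact h⟩

variable {σ : ι → Equiv.Perm T}

theorem permBipartite_adj_inl_inr {x y : T} :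
    (permBipartite σ).Adj (.inl x) (.inr y) ↔ ∃ t, σ t x = y := Iff.rfl

theorem permBipartite_adj_inl {x : T} {w : T ⊕ T} :
    (permBipartite σ).Adj (.inl x) w ↔ ∃ t, .inr (σ t x) = w := by
  cases w <;> simp [permBipartite]

theorem permBipartite_adj_inr {y : T} {w : T ⊕ T} :
    (permBipartite σ).Adj (.inr y) w ↔ ∃ t, .inl ((σ t).symm y) = w := by
  rcases w with x | x
  · simp only [Sum.inl.injEq, Equiv.symm_apply_eq]
    exact exists_congr fun t => eq_comm
  · simp [permBipartite]

section Neighbors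

theorem permBipartite_symm_injective (hσ : ∀ x, Function.Injective fun t => σ t x) (y : T) :
    Function.Injective fun t => (σ t).symm y :=
  fun t s h => hσ ((σ t).symm y) (by
    dsimp only at h ⊢
    rw [Equiv.apply_symm_apply, h, Equiv.apply_symm_apply])

variable [Fintype ι] [DecidableEq T]

theorem sum_neighborFinset_inl {M : Type*} [AddCommMonoid M]
    (hσ : ∀ x, Function.Injective fun t => σ t x) (x : T)
    [Fintype ((permBipartite σ).neighborSet (.inl x))] (f : T ⊕ T → M) :
    ∑ w ∈ (permBipartite σ).neighborFinset (.inl x), f w = ∑ t, f (.inr (σ t x)) := by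
  have : (permBipartite σ).neighborFinset (.inl x) =
      Finset.univ.image fun t => .inr (σ t x) := by
    ext w
    simp [permBipartite_adj_inl]
  rw [this, Finset.sum_image fun _ _ _ _ h => hσ x (Sum.inr_injective h)]

theorem sum_neighborFinset_inr {M : Type*} [AddCommMonoid M]
    (hσ : ∀ x, Function.Injective fun t => σ t x) (y : T)
    [Fintype ((permBipartite σ).neighborSet (.inr y))] (f : T ⊕ T → M) :
    ∑ w ∈ (permBipartite σ).neighborFinset (.inr y), f w = ∑ t, f (.inl ((σ t).symm y)) := by
  have : (permBipartite σ).neighborFinset (.inr y) =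
      Finset.univ.image fun t => .inl ((σ t).symm y) := by
    ext w
    simp [permBipartite_adj_inr]
  rw [this, Finset.sum_image fun _ _ _ _ h =>
    permBipartite_symm_injective hσ y (Sum.inl_injective h)]

theorem permBipartite_isRegularOfDegree [(permBipartite σ).LocallyFinite]
    (hσ : ∀ x, Function.Injective fun t => σ t x) :
    (permBipartite σ).IsRegularOfDegree (Fintype.card ι) := by
  rintro (x | x)
  · rw [← SimpleGraph.card_neighborFinset_eq_degree, Finset.card_eq_sum_ones,
      sum_neighborFinset_inl hσ]
    simp
  · rw [← SimpleGraph.card_neighborFinset_eq_degree, Finset.card_eq_sum_ones,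
      sum_neighborFinset_inr hσ]
    simp

/-- A common eigenvector `f` of `∑ t, σ t` and its transpose gives the eigenvector `(f, -f)`. -/
theorem isAdjEigenvalue_permBipartite_neg [Fintype T]
    (hσ : ∀ x, Function.Injective fun t => σ t x) {f : T → ℝ} (hf : f ≠ 0) {μ : ℝ}
    (h : ∀ x, ∑ t, f (σ t x) = μ * f x) (h' : ∀ x, ∑ t, f ((σ t).symm x) = μ * f x) :
    IsAdjEigenvalue (permBipartite σ) (-μ) := by
  classical
  refine isAdjEigenvalue_iff.2 ⟨Sum.elim f (-f), fun h0 => hf ?_, ?_⟩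
  · ext x
    simpa using congrFun h0 (.inl x)
  · ext w
    rw [SimpleGraph.adjMatrix_mulVec_apply]
    rcases w with x | x
    · rw [sum_neighborFinset_inl hσ]
      simp [h]
    · rw [sum_neighborFinset_inr hσ]
      simp [h']

end Neighbors

/-- The edge `(x, t)` receives the colour `(t, ℓ t x)`. Edges `(x, t)` and `(y, t)` within distance
2 that do not share a vertex are joined by an edge `(x, u)` or `(y, u)` with `u ≠ t`, so the
hypothesis says that their second colour components differ. -/
theorem edgeDistGraph_two_permBipartite_colorable [Fintype ι] (ℓ : ι → T → Bool)
    (hℓ : ∀ t u x y, u ≠ t → σ t y = σ u x → ℓ t y ≠ ℓ t x) :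
    (edgeDistGraph (permBipartite σ) 2).Colorable (2 * Fintype.card ι) := by
  classical
  have hedge : ∀ e : (permBipartite σ).edgeSet,
      ∃ p : T × ι, (e : Sym2 (T ⊕ T)) = s(.inl p.1, .inr (σ p.2 p.1)) := by
    rintro ⟨e, he⟩
    induction e with
    | _ a b =>
      rcases a with x | x <;> rcases b with y | y
      · exact he.elim
      · obtain ⟨t, rfl⟩ := he
        exact ⟨(x, t), rfl⟩
      · obtain ⟨t, rfl⟩ := he
        exact ⟨(y, t), Sym2.eq_swap⟩
      · exact he.elim
  choose p hp using hedge
  -- the left end of one edge adjacent to the right end of the other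
  have hcross : ∀ t x y, (permBipartite σ).Adj (.inl x) (.inr (σ t y)) → ℓ t y = ℓ t x →
      x = y := by
    rintro t x y ⟨u, hu⟩ hl
    by_cases hut : u = t
    · exact (σ t).injective (hut ▸ hu)
    · exact absurd hl (hℓ t u x y hut hu.symm)
  let C : (edgeDistGraph (permBipartite σ) 2).Coloring (ι × Bool) :=
    SimpleGraph.Coloring.mk (fun e => ((p e).2, ℓ (p e).2 (p e).1)) <| by
      rintro e f ⟨hne, a, ha, b, hb, w, hw⟩ hcol
      obtain ⟨ht, hl⟩ := Prod.mk.inj hcol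
      rw [← ht] at hl
      have hab : a = b ∨ (permBipartite σ).Adj a b := by
        rcases Nat.lt_or_ge w.length 1 with h | h
        · exact .inl (SimpleGraph.Walk.eq_of_length_eq_zero (p := w) (by omega))
        · exact .inr (SimpleGraph.Walk.adj_of_length_eq_one (p := w) (by omega))
      have hx : (p e).1 = (p f).1 := by
        rw [hp, Sym2.mem_iff] at ha hb
        rw [← ht] at hb
        rcases ha with rfl | rfl <;> rcases hb with rfl | rfl <;> rcases hab with hab | hab
        · exact Sum.inl_injective hab
        · exact hab.elim
        · exact absurd hab Sum.inl_ne_inr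
        · exact hcross _ _ _ hab hl.symm
        · exact absurd hab Sum.inr_ne_inl
        · exact (hcross _ _ _ hab.symm hl).symm
        · exact (σ _).injective (Sum.inr_injective hab)
        · exact hab.elim
      exact hne (Subtype.ext (by rw [hp e, hp f, ← ht, hx]))
  have := C.colorable
  rwa [Fintype.card_prod, Fintype.card_bool, mul_comm] at this

end PermBipartite

/-! ### Matching orderings of cycles -/

section Cycle

/-- In a 2-regular graph with a matching ordering, every `v i` has a single neighbour `u (P i)`
other than `u i`, and `P` is a permutation. -/
theorem MatchingOrdering.exists_perm {W : Type*} {G : SimpleGraph W} [G.LocallyFinite] {r : ℕ}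
    (O : MatchingOrdering G r) (hG : G.IsRegularOfDegree 2) :
    ∃ P : Equiv.Perm (Fin r), (∀ i, P i ≠ i) ∧
      ∀ i k, G.Adj (O.v i) (O.u k) ↔ k = i ∨ k = P i := by
  classical
  have hv : Function.Injective O.v := fun i j h =>
    Sum.inl_injective (O.bijective.1 <|
      show Sum.elim O.v O.u (.inl i) = Sum.elim O.v O.u (.inl j) from h)
  have hu : Function.Injective O.u := fun i j h =>
    Sum.inr_injective (O.bijective.1 <|
      show Sum.elim O.v O.u (.inr i) = Sum.elim O.v O.u (.inr j) from h)
  have hother : ∀ i, ∃ k, k ≠ i ∧ ∀ l, G.Adj (O.v i) (O.u l) ↔ l = i ∨ l = k := fun i => by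
    have hmem : O.u i ∈ G.neighborFinset (O.v i) := by simpa using O.adj i
    have hcard : ((G.neighborFinset (O.v i)).erase (O.u i)).card = 1 := by
      rw [Finset.card_erase_of_mem hmem, SimpleGraph.card_neighborFinset_eq_degree, hG]
    obtain ⟨w, hw⟩ := Finset.card_eq_one.1 hcard
    have hw' : ∀ z, (z ≠ O.u i ∧ G.Adj (O.v i) z) ↔ z = w := fun z => by
      simpa using Finset.ext_iff.1 hw z
    obtain ⟨hne, hadj⟩ := (hw' w).2 rfl
    obtain ⟨j | k, rfl⟩ := O.bijective.2 w
    · exact absurd hadj (O.not_adj_v i j)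
    · refine ⟨k, fun h => hne (by simp [h]), fun l => ⟨fun h => ?_, ?_⟩⟩
      · by_cases hl : l = i
        · exact .inl hl
        · exact .inr (hu ((hw' _).1 ⟨fun h => hl (hu h), h⟩))
      · rintro (rfl | rfl)
        · exact O.adj _
        · exact hadj
  choose P hP hadj using hother
  have hinj : Function.Injective P := fun i j hij => by
    by_contra hne
    -- otherwise `u (P i)` would have the three neighbours `v i`, `v j` and `v (P i)`
    have hsub : ({O.v i, O.v j, O.v (P i)} : Finset W) ⊆ G.neighborFinset (O.u (P i)) := by
      intro w hw
      rw [SimpleGraph.mem_neighborFinset, SimpleGraph.adj_comm]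
      simp only [Finset.mem_insert, Finset.mem_singleton] at hw
      rcases hw with rfl | rfl | rfl
      · exact (hadj i _).2 (.inr rfl)
      · exact (hadj j _).2 (.inr hij)
      · exact O.adj _
    have hle := Finset.card_le_card hsub
    rw [SimpleGraph.card_neighborFinset_eq_degree, hG, Finset.card_eq_three.2
      ⟨_, _, _, hv.ne hne, hv.ne (hP i).symm, hv.ne (hij ▸ (hP j).symm), rfl⟩] at hle
    omega
  exact ⟨Equiv.ofBijective P (Finite.injective_iff_bijective.1 hinj), hP, hadj⟩

theorem MatchingOrdering.two_mul_eq {n r : ℕ} {G : SimpleGraph (Fin n)}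
    (O : MatchingOrdering G r) : 2 * r = n := by
  have := Fintype.card_of_bijective O.bijective
  simp only [Fintype.card_sum, Fintype.card_fin] at this
  omega

theorem cycleGraph_adj_val {n : ℕ} {a b : Fin n} (h : (SimpleGraph.cycleGraph n).Adj a b) :
    a.val = b.val + 1 ∨ b.val = a.val + 1 ∨ (a.val = 0 ∧ b.val + 1 = n) ∨
      (b.val = 0 ∧ a.val + 1 = n) := by
  have key : ∀ x y : Fin n, (x - y).val = 1 → x.val = y.val + 1 ∨ (x.val = 0 ∧ y.val + 1 = n) := by
    intro x y hxy
    rcases le_or_gt y x with h | h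
    · rw [Fin.coe_sub_iff_le.2 h] at hxy
      omega
    · rw [Fin.coe_sub_iff_lt.2 h] at hxy
      omega
  rcases SimpleGraph.cycleGraph_adj'.1 h with h | h
  · have := key _ _ h
    omega
  · have := key _ _ h
    omega

/-- Two vertices of a cycle with a common neighbour differ by 2. When 4 divides the length this
changes the parity of half the position. -/
theorem cycleGraph_half_parity_ne {n : ℕ} (hn : 4 ∣ n) {a b c : Fin n} (hab : a ≠ b)
    (ha : (SimpleGraph.cycleGraph n).Adj a c) (hb : (SimpleGraph.cycleGraph n).Adj b c) :
    a.val / 2 % 2 ≠ b.val / 2 % 2 := by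
  have h1 := cycleGraph_adj_val ha
  have h2 := cycleGraph_adj_val hb
  have h3 : a.val ≠ b.val := Fin.val_ne_of_ne hab
  omega

/-- The combinatorial content of a matching ordering of a cycle of length divisible by 4: the
matching `u i` aside, the edges are given by a permutation `P`, and the indices have a proper
2-colouring along `P`. -/
theorem MatchingOrdering.exists_perm_parity {n r : ℕ} (hn3 : 3 ≤ n) (hn : 4 ∣ n)
    (O : MatchingOrdering (SimpleGraph.cycleGraph n) r) :
    ∃ (P : Equiv.Perm (Fin r)) (χ : Fin r → Bool), (∀ i, χ (P i) = !χ i) ∧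
      ∀ i k, (SimpleGraph.cycleGraph n).Adj (O.v i) (O.u k) ↔ k = i ∨ k = P i := by
  classical
  have hreg : (SimpleGraph.cycleGraph n).IsRegularOfDegree 2 := by
    obtain ⟨m, rfl⟩ := Nat.exists_eq_add_of_le' hn3
    exact fun v => SimpleGraph.cycleGraph_degree_three_le
  obtain ⟨P, hP, hadj⟩ := O.exists_perm hreg
  refine ⟨P, fun i => decide ((O.v i).val / 2 % 2 = 0), fun i => ?_, hadj⟩
  have hne : O.v (P i) ≠ O.v i := fun h => hP i <| Sum.inl_injective <| O.bijective.1 <|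
    show Sum.elim O.v O.u (.inl (P i)) = Sum.elim O.v O.u (.inl i) from h
  have h := cycleGraph_half_parity_ne hn hne (O.adj (P i)) ((hadj i (P i)).2 (.inr rfl))
  rw [← decide_not, decide_eq_decide]
  omega

end Cycle

/-! ### The product of two cycles -/

section Product

/-- The three permutations of the index pairs describing `C_q ⋈ C_q'`. -/
def productPerm {r r' : ℕ} (P : Equiv.Perm (Fin r)) (P' : Equiv.Perm (Fin r')) :
    Fin 3 → Equiv.Perm (Fin r × Fin r') :=
  ![Equiv.refl _, P.prodCongr (Equiv.refl _), (Equiv.refl _).prodCongr P']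

theorem balBipProduct_eq_permBipartite {W W' : Type*} {G : SimpleGraph W} {G' : SimpleGraph W'}
    {r r' : ℕ} (O : MatchingOrdering G r) (O' : MatchingOrdering G' r')
    {P : Equiv.Perm (Fin r)} {P' : Equiv.Perm (Fin r')}
    (h : ∀ i k, G.Adj (O.v i) (O.u k) ↔ k = i ∨ k = P i)
    (h' : ∀ i k, G'.Adj (O'.v i) (O'.u k) ↔ k = i ∨ k = P' i) :
    balBipProduct O O' = permBipartite (productPerm P P') := by
  have key : ∀ x y : Fin r × Fin r', (balBipProduct O O').Adj (.inl x) (.inr y) ↔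
      (permBipartite (productPerm P P')).Adj (.inl x) (.inr y) := by
    rintro ⟨i, j⟩ ⟨k, l⟩
    rw [permBipartite_adj_inl_inr, Fin.exists_fin_succ, Fin.exists_fin_two]
    simp only [balBipProduct, h, h', productPerm]
    simp
    grind
  ext (x | x) (y | y)
  · rfl
  · exact key x y
  · rw [SimpleGraph.adj_comm, key, SimpleGraph.adj_comm]
  · rfl

variable {r r' : ℕ} {P : Equiv.Perm (Fin r)} {P' : Equiv.Perm (Fin r')} {χ : Fin r → Bool}
  {χ' : Fin r' → Bool}

/-- The edges `(x, t)` of each of the three types are split in two by a parity of their left end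
that the permutations `(σ t)⁻¹ ∘ σ u`, `u ≠ t`, change. -/
def productParity (χ : Fin r → Bool) (χ' : Fin r' → Bool) : Fin 3 → Fin r × Fin r' → Bool :=
  ![fun x => xor (χ x.1) (χ' x.2), fun x => χ x.1, fun x => χ' x.2]

theorem productParity_ne (hχ : ∀ i, χ (P i) = !χ i) (hχ' : ∀ j, χ' (P' j) = !χ' j) (t u : Fin 3)
    (x y : Fin r × Fin r') (hut : u ≠ t) (h : productPerm P P' t y = productPerm P P' u x) :
    productParity χ χ' t y ≠ productParity χ χ' t x := by
  obtain ⟨i, j⟩ := x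
  obtain ⟨k, l⟩ := y
  fin_cases t <;> fin_cases u <;> simp [productPerm] at hut h <;> obtain ⟨h1, h2⟩ := h <;>
    have e1 := congrArg χ h1 <;> have e2 := congrArg χ' h2 <;>
    simp_all [productParity] <;> grind

theorem productPerm_injective (hχ : ∀ i, χ (P i) = !χ i) (hχ' : ∀ j, χ' (P' j) = !χ' j)
    (x : Fin r × Fin r') : Function.Injective fun t => productPerm P P' t x := by
  intro t u h
  by_contra hut
  exact productParity_ne hχ hχ' t u x x (Ne.symm hut) h rfl

/-- The sign given by the parity of the second index is fixed by two of the three permutations and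
negated by the third. -/
theorem isAdjEigenvalue_product_neg_one [Nonempty (Fin r × Fin r')]
    (hχ : ∀ i, χ (P i) = !χ i) (hχ' : ∀ j, χ' (P' j) = !χ' j) :
    IsAdjEigenvalue (permBipartite (productPerm P P')) (-1) := by
  let s : Bool → ℝ := fun b => if b then 1 else -1
  have hs : ∀ b, s (!b) = -s b := by simp [s]
  have hsymm : ∀ j, χ' (P'.symm j) = !χ' j := fun j => by
    rw [← P'.apply_symm_apply j, hχ', P'.symm_apply_apply, Bool.not_not]
  refine isAdjEigenvalue_permBipartite_neg (productPerm_injective hχ hχ')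
    (f := fun x => s (χ' x.2)) (fun h => ?_) (fun x => ?_) (fun x => ?_)
  · have := congrFun h (Classical.arbitrary _)
    simp only [s, Pi.zero_apply] at this
    split_ifs at this <;> norm_num at this
  · simp [Fin.sum_univ_three, productPerm, hχ', hs]
  · rw [Fin.sum_univ_three]
    simp [productPerm, hsymm, hs]

end Product

/-! ### The distance-2 chromatic index of the product of two cycles -/

theorem proposition4p2 (q q' r r' : ℕ) (hq3 : 3 ≤ q) (hq3' : 3 ≤ q') (hq : 4 ∣ q) (hq' : 4 ∣ q')
    (O : MatchingOrdering (SimpleGraph.cycleGraph q) r)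
    (O' : MatchingOrdering (SimpleGraph.cycleGraph q') r')
    (h : ¬ IsAdjEigenvalue (balBipProduct O O') (-2) ∨
      (IsAdjEigenvalue (balBipProduct O O') (-2) ∧ ¬ 5 ∣ q * q')) :
    ∃ B : ℝ, IsHoffmanBoundTwo (balBipProduct O O') B ∧
      distChromaticIndex (balBipProduct O O') 2 = 6 ∧ ⌈B⌉ = 6 := by
  classical
  have hr := O.two_mul_eq
  have hr' := O'.two_mul_eq
  obtain ⟨P, χ, hχ, hadj⟩ := O.exists_perm_parity hq3 hq
  obtain ⟨P', χ', hχ', hadj'⟩ := O'.exists_perm_parity hq3' hq'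
  rw [balBipProduct_eq_permBipartite O O' hadj hadj'] at h ⊢
  set H := permBipartite (productPerm P P')
  have : Nonempty (Fin r × Fin r') := ⟨⟨0, by omega⟩, ⟨0, by omega⟩⟩
  have hreg : H.IsRegularOfDegree 3 :=
    permBipartite_isRegularOfDegree (productPerm_injective hχ hχ')
  have hcard : H.edgeSet.ncard = 3 * (r * r') := by
    have := two_mul_ncard_edgeSet hreg
    simp only [Fintype.card_sum, Fintype.card_prod, Fintype.card_fin] at this
    omega
  have h5 : IsAdjEigenvalue H (-2) → ¬ 5 ∣ H.edgeSet.ncard := fun h2 hdvd => by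
    obtain hn | ⟨-, hn⟩ := h
    · exact hn h2
    · have : 5 ∣ r * r' := (Nat.Coprime.dvd_mul_left (by norm_num)).1 (hcard ▸ hdvd)
      exact hn (by rw [← hr, ← hr', mul_mul_mul_comm]; exact this.mul_left _)
  obtain ⟨m, hm⟩ : 2 ∣ r * r' := Dvd.dvd.mul_right (by omega) _
  obtain ⟨B, hB, hB6⟩ := exists_isHoffmanBoundTwo_ceil_eq_six hreg (m := m) (by omega)
    (isAdjEigenvalue_product_neg_one hχ hχ') h5
  refine ⟨B, hB, ?_, hB6⟩
  have hle : (edgeDistGraph H 2).Colorable 6 :=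
    edgeDistGraph_two_permBipartite_colorable _ (productParity_ne hχ hχ')
  have hnot : ¬ (edgeDistGraph H 2).Colorable 5 := fun hcol => by
    obtain ⟨h1, hdvd⟩ := of_edgeDistGraph_two_colorable hreg (by norm_num) hcol
    have h2 := h1.of_lineGraph hreg (by norm_num)
    norm_num at h2
    exact h5 h2 hdvd
  exact SimpleGraph.chromaticNumber_eq_iff_colorable_not_colorable.2 ⟨hle, hnot⟩
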